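/- Setting. Let $\mathcal A$ be a finite nonempty set of candidates and let $f$ be a centered Gaussian process on $\mathcal A$ with covariance function $\mathrm k$, where $\mathrm k(x,x)\le\kappa^2$ for all $x\in\mathcal A$. Evaluating a candidate $x_t$ at step $t$ returns the feedback $y_t=f(x_t)+\eta_t$, where $\eta_1,\eta_2,\dots$ are i.i.d. $\mathcal N(0,\xi^2)$ with $\xi>0$, independent of $f$. Put $\lambda=\xi^2$. With $X_t=(x_1,\dots,x_t)$, $\mathbf y_t=(y_1,\dots,y_t)^{\mathsf T}$ and $K_t=\mathrm k(X_t,X_t)$, the posterior mean and variance are $$\mu_t(x)=\mathrm k(x,X_t)(K_t+\lambda I)^{-1}\mathbf y_t,\qquad \sigma_t^2(x)=\mathrm k(x,x)-\mathrm k(x,X_t)(K_t+\lambda I)^{-1}\mathrm k(X_t,x).$$ The maximum information gain is $\gamma_T=\max_{X\in\mathcal A^T}\tfrac12\log\det\bigl(I+\xi^{-2}\mathrm k(X,X)\bigr)$, and the cumulative regret is $R_T=\sum_{t=1}^T\bigl(\max_{x\in\mathcal A}f(x)-f(x_t)\bigr)$. Mini-GP-UCB with threshold $C>1$ proceeds in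 epochs. If an epoch begins after $t$ completed steps, the algorithm selects $$x_{t+1}\in\arg\max_{x\in\mathcal A}\ \mu_t(x)+\beta_{t+1}\sigma_t(x),\qquad \beta_t=\sqrt{2\log\bigl(|\mathcal A|\,t^2\pi^2/(6\delta)\bigr)},$$ where ties are broken by any measurable rule that depends only on the feedback observed so far. It evaluates this candidate $B=\max\bigl\{1,\lfloor (C^2-1)/\sigma_t^2(x_{t+1})\rfloor\bigr\}$ times (forever if $\sigma_t(x_{t+1})=0$), and then begins the next epoch. Theorem. There is an absolute constant $p\in\mathbb N$ and, for all $\kappa$ and $\xi>0$, a constant $K>0$ depending only on $\kappa$ and $\xi$, such that in this setting, for every $C>1$ and every $\delta\in(0,1]$, the candidates selected by mini-GP-UCB satisfy, with probability at least $1-\delta$, $$R_T\ \le\ K\,\Bigl(1+\log\tfrac{|\mathcal A|\,T}{\delta}\Bigr)^{p}\;C\sqrt{T\gamma_T}\qquad\text{for all }T\ge1 ;$$ that is, $R_T\le\widetilde{\mathcal O}\bigl(C\sqrt{T\gamma_T}\bigr)$, where $\widetilde{\mathcal O}$ hides factors that are polylogarithmic in $|\mathcal A|$, $T$ and $1/\delta$,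 and constants that depend on $\kappa$ and $\xi$. -/

import Mathlib

open MeasureTheory ProbabilityTheory

noncomputable section

namespace MiniGP

variable {A : Type*}

/-- The kernel matrix `k(X, X)` of a finite sequence `X` of candidates (repetitions allowed). -/
def kernelMatrix (k : A → A → ℝ) {t : ℕ} (X : Fin t → A) : Matrix (Fin t) (Fin t) ℝ :=
  Matrix.of fun i j => k (X i) (X j)

/-- Posterior mean `k(a, X) (k(X, X) + lam I)⁻¹ y` at the point `a`, given the feedback `y`
observed at the candidates `X`. -/
def postMean (k : A → A → ℝ) (lam : ℝ) {t : ℕ} (X : Fin t → A) (y : Fin t → ℝ) (a : A) : ℝ :=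
  (fun i => k a (X i)) ⬝ᵥ
    (Matrix.mulVec (kernelMatrix k X + lam • (1 : Matrix (Fin t) (Fin t) ℝ))⁻¹ y)

/-- Posterior variance `k(a, a) - k(a, X) (k(X, X) + lam I)⁻¹ k(X, a)` at the point `a`. -/
def postVar (k : A → A → ℝ) (lam : ℝ) {t : ℕ} (X : Fin t → A) (a : A) : ℝ :=
  k a a - (fun i => k a (X i)) ⬝ᵥ
    (Matrix.mulVec (kernelMatrix k X + lam • (1 : Matrix (Fin t) (Fin t) ℝ))⁻¹
      (fun i => k (X i) a))

/-- The GP-UCB acquisition function with exploration coefficient `b`: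
posterior mean plus `b` times the posterior standard deviation. -/
def ucb (k : A → A → ℝ) (lam b : ℝ) {t : ℕ} (X : Fin t → A) (y : Fin t → ℝ) (a : A) : ℝ :=
  postMean k lam X y a + b * Real.sqrt (postVar k lam X a)

/-- Length of an epoch whose candidate has posterior variance `v` at the start of the epoch:
`⌊(C² - 1) / v⌋`, but at least one evaluation, and infinite (the epoch never ends) if `v = 0`. -/
def batchLength (C v : ℝ) : ℕ∞ :=
  open Classical in if v = 0 then ⊤ else ((max 1 ⌊(C ^ 2 - 1) / v⌋₊ : ℕ) : ℕ∞)

/-- `x t` is the candidate evaluated at step `t + 1`. `epochStart k lam C x t` is the number of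
steps completed before the beginning of the epoch that contains step `t + 1`. A new epoch begins
as soon as the current one has reached its length, which is fixed at its beginning. -/
def epochStart (k : A → A → ℝ) (lam C : ℝ) (x : ℕ → A) : ℕ → ℕ
  | 0 => 0
  | t + 1 =>
    let s := epochStart k lam C x t
    open Classical in
    if ((t + 1 : ℕ) : ℕ∞) < (s : ℕ∞) + batchLength C (postVar k lam (fun i : Fin s => x i) (x s))
    then s else t + 1

/-- The candidates `x` and the feedback `y` (`x t` and `y t` belong to step `t + 1`) form a run of
mini-GP-UCB with regularization `lam`, threshold `C` and exploration coefficients `β`: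
at the first step `t + 1` of each epoch the candidate maximizes the acquisition function
`μ_t + β_{t+1} σ_t` built from the data of the first `t` steps, and this candidate is repeated
until the end of the epoch. -/
structure IsRun (k : A → A → ℝ) (lam C : ℝ) (β : ℕ → ℝ) (x : ℕ → A) (y : ℕ → ℝ) : Prop where
  select : ∀ t, epochStart k lam C x t = t → ∀ a,
    ucb k lam (β (t + 1)) (fun i : Fin t => x i) (fun i : Fin t => y i) a ≤
      ucb k lam (β (t + 1)) (fun i : Fin t => x i) (fun i : Fin t => y i) (x t)
  repeated : ∀ t, x t = x (epochStart k lam C x t)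

/-- A (measurable) decision rule `sel`, which maps the feedback of the first `t` steps to the
candidate of step `t + 1`, implements mini-GP-UCB if it produces a run of mini-GP-UCB for every
feedback sequence. Two such rules differ only in how they break ties between maximizers. -/
structure IsMiniGPUCB (k : A → A → ℝ) (lam C : ℝ) (β : ℕ → ℝ)
    (sel : (t : ℕ) → (Fin t → ℝ) → A) : Prop where
  measurable : ∀ t a, MeasurableSet (sel t ⁻¹' {a})
  isRun : ∀ y : ℕ → ℝ, IsRun k lam C β (fun t => sel t (fun i => y i)) y

/-- `β_t = √(2 log(n t² π² / (6 δ)))`, where `n` is the number of candidates. -/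
def betaBayes (n : ℕ) (δ : ℝ) (t : ℕ) : ℝ :=
  Real.sqrt (2 * Real.log (n * (t : ℝ) ^ 2 * Real.pi ^ 2 / (6 * δ)))

/-- Information gain `½ log det(I + ξ⁻² k(X, X))`. -/
def infoGain (k : A → A → ℝ) (ξ : ℝ) {t : ℕ} (X : Fin t → A) : ℝ :=
  1 / 2 * Real.log (1 + (ξ ^ 2)⁻¹ • kernelMatrix k X).det

/-- Maximum information gain `γ_t`: the maximum of the information gain over all sequences of `t`
candidates, repetitions allowed (there are finitely many if `A` is finite). -/
def maxInfoGain (k : A → A → ℝ) (ξ : ℝ) (t : ℕ) : ℝ :=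
  ⨆ X : Fin t → A, infoGain k ξ X

/-- Cumulative regret `R_T = ∑_{t = 1}^T (f⋆ - f(x_t))`, with `f⋆ = max f`. -/
def regret (f : A → ℝ) (x : ℕ → A) (T : ℕ) : ℝ :=
  ∑ t ∈ Finset.range T, ((⨆ a, f a) - f (x t))

variable {Ω : Type*} [MeasurableSpace Ω]

/-- `f` is a Gaussian process on `A` with mean zero and covariance function `k`. -/
structure IsCenteredGP (k : A → A → ℝ) (f : A → Ω → ℝ) (P : Measure Ω) : Prop where
  gaussian : IsGaussianProcess f P
  mean_zero : ∀ a, ∫ ω, f a ω ∂P = 0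
  cov_eq : ∀ a b, cov[f a, f b; P] = k a b

/-- `η` is a sequence of i.i.d. `N(0, ξ²)` variables, independent of the random function `f`. -/
structure IsGaussianNoise (ξ : ℝ) (f : A → Ω → ℝ) (η : ℕ → Ω → ℝ) (P : Measure Ω) : Prop where
  law : ∀ t, HasLaw (η t) (gaussianReal 0 (Real.toNNReal (ξ ^ 2))) P
  iIndep : iIndepFun η P
  indep : IndepFun (fun ω a => f a ω) (fun ω t => η t ω) P

end MiniGP

end

/-!
For a *fixed* sequence of candidates, the error of the posterior mean at `a` is a centered Gaussian
with variance `σ_t(a)²` that is independent of the feedback. The candidates chosen by a decision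
rule are functions of this feedback. So partitioning the probability space according to the chosen
sequence shows that the Gaussian tail bound survives adaptive selection, and a union bound over `A`
and `t` gives confidence bounds `|f - μ_t| ≤ β_{t+1} σ_t` that hold simultaneously with probability
`1 - δ`.

On this event the regret of every step of an epoch is at most `2 β σ_s(x)`, where `s` is the start
of the epoch and `x` its candidate. Embedding `A` into a Hilbert space turns `σ²` into the minimum
of a least squares problem, from which one reads off that evaluating `x` increases `1 / σ²(x)` by
at most `1 / λ`. Since at most `(C² - 1) / σ_s(x)²` evaluations in the epoch precede any given step,
`σ` decreases by a factor of at most `C √(1 + 1 / λ)` within an epoch, and `σ_s(x)` may be replaced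
by the current standard deviation. The sum of these is bounded by Cauchy–Schwarz, because the
information gain is `½ ∑ log (1 + σ_t² / λ)`.
-/

noncomputable section

namespace MiniGP

open Matrix
open scoped RealInnerProductSpace

variable {A : Type*}

/-- The first `t` terms of a sequence: the data available after `t` steps. -/
abbrev history {α : Type*} (x : ℕ → α) (t : ℕ) : Fin t → α := fun i => x i

/-- The regularized kernel matrix `k(X, X) + lam I`. -/
def regMatrix (k : A → A → ℝ) (lam : ℝ) {t : ℕ} (X : Fin t → A) : Matrix (Fin t) (Fin t) ℝ :=
  kernelMatrix k X + lam • (1 : Matrix (Fin t) (Fin t) ℝ)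

/-- The weights `k(a, X) (k(X, X) + lam I)⁻¹` of the observations in the posterior mean at `a`. -/
def postWeights (k : A → A → ℝ) (lam : ℝ) {t : ℕ} (X : Fin t → A) (a : A) : Fin t → ℝ :=
  (fun i => k a (X i)) ᵥ* (regMatrix k lam X)⁻¹

lemma history_add_of_repeated {α : Type*} {x : ℕ → α} {s b : ℕ} {a : α}
    (hx : ∀ i < b, x (s + i) = a) :
    history x (s + b) = Fin.append (history x s) fun _ : Fin b => a := by
  ext i
  induction i using Fin.addCases with
  | left i => rw [Fin.append_left]; rfl
  | right i => rw [Fin.append_right]; exact hx i i.isLt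

lemma history_succ {α : Type*} (x : ℕ → α) (t : ℕ) :
    history x (t + 1) = Fin.append (history x t) fun _ : Fin 1 => x t :=
  history_add_of_repeated fun i hi => by rw [Nat.lt_one_iff.1 hi, add_zero]

section Posterior

variable {k : A → A → ℝ} {lam : ℝ} {t : ℕ}

lemma postMean_eq_postWeights_dotProduct (X : Fin t → A) (y : Fin t → ℝ) (a : A) :
    postMean k lam X y a = postWeights k lam X a ⬝ᵥ y :=
  dotProduct_mulVec _ _ _

lemma postVar_eq_sub_postWeights_dotProduct (X : Fin t → A) (a : A) :
    postVar k lam X a = k a a - postWeights k lam X a ⬝ᵥ fun i => k (X i) a :=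
  congrArg (k a a - ·) (dotProduct_mulVec _ _ _)

lemma postWeights_vecMul_regMatrix {X : Fin t → A} (hX : IsUnit (regMatrix k lam X)) (a : A) :
    postWeights k lam X a ᵥ* regMatrix k lam X = fun i => k a (X i) := by
  rw [postWeights, vecMul_vecMul, nonsing_inv_mul _ ((isUnit_iff_isUnit_det _).1 hX), vecMul_one]

/-- The posterior variance, up to the noise level, is a Schur complement. -/
lemma det_regMatrix_append {X : Fin t → A} (hX : IsUnit (regMatrix k lam X)) (a : A) :
    (regMatrix k lam (Fin.append X fun _ : Fin 1 => a)).det =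
      (regMatrix k lam X).det * (lam + postVar k lam X a) := by
  let _ := invertibleOfIsUnitDet _ ((isUnit_iff_isUnit_det _).1 hX)
  have hblock : (regMatrix k lam (Fin.append X fun _ : Fin 1 => a)).submatrix
      finSumFinEquiv finSumFinEquiv = fromBlocks (regMatrix k lam X)
        (of fun i _ => k (X i) a) (of fun _ j => k a (X j)) (of fun _ _ => k a a + lam) := by
    ext i j
    rcases i with i | i <;> rcases j with j | j <;>
      simp [regMatrix, kernelMatrix, one_apply, Fin.ext_iff, i.isLt.ne, j.isLt.ne',
        Fin.fin_one_eq_zero]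
  rw [← det_submatrix_equiv_self finSumFinEquiv, hblock, det_fromBlocks₁₁, det_fin_one,
    invOf_eq_nonsing_inv, postVar_eq_sub_postWeights_dotProduct]
  change _ * (k a a + lam - postWeights k lam X a ⬝ᵥ fun i => k (X i) a) = _
  ring

end Posterior

section FeatureMap

variable {E : Type*} [NormedAddCommGroup E] [InnerProductSpace ℝ E] {k : A → A → ℝ} {φ : A → E}
  {lam : ℝ} {t : ℕ}

lemma kernelMatrix_eq_gram (hk : ∀ a b, ⟪φ a, φ b⟫ = k a b) (X : Fin t → A) :
    kernelMatrix k X = gram ℝ (φ ∘ X) := by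
  ext i j
  simp [kernelMatrix, hk]

lemma regMatrix_posDef (hk : ∀ a b, ⟪φ a, φ b⟫ = k a b) (hlam : 0 < lam) (X : Fin t → A) :
    (regMatrix k lam X).PosDef := by
  rw [regMatrix, kernelMatrix_eq_gram hk]
  exact PosDef.posSemidef_add (posSemidef_gram ℝ _) (PosDef.one.smul hlam)

lemma regMatrix_mulVec_postWeights (hk : ∀ a b, ⟪φ a, φ b⟫ = k a b) (hlam : 0 < lam)
    (X : Fin t → A) (a : A) :
    regMatrix k lam X *ᵥ postWeights k lam X a = fun i => k (X i) a := by
  have hS := regMatrix_posDef hk hlam X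
  have hsymm : (regMatrix k lam X)ᵀ = regMatrix k lam X := hS.isHermitian
  rw [← hsymm, mulVec_transpose, postWeights_vecMul_regMatrix hS.isUnit]
  simp only [← hk, real_inner_comm]

lemma norm_sq_add_eq_quadratic (hk : ∀ a b, ⟪φ a, φ b⟫ = k a b) (X : Fin t → A) (a : A) (u : ℝ)
    (w : Fin t → ℝ) :
    ‖u • φ a - ∑ i, w i • φ (X i)‖ ^ 2 + lam * (w ⬝ᵥ w) =
      u ^ 2 * k a a - 2 * u * (w ⬝ᵥ fun i => k (X i) a) + w ⬝ᵥ (regMatrix k lam X *ᵥ w) := by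
  have hgram : w ⬝ᵥ (kernelMatrix k X *ᵥ w) = ‖∑ i, w i • φ (X i)‖ ^ 2 := by
    rw [kernelMatrix_eq_gram hk, ← real_inner_self_eq_norm_sq]
    exact star_dotProduct_gram_mulVec (φ ∘ X) w w
  have hcross : ⟪φ a, ∑ i, w i • φ (X i)⟫ = w ⬝ᵥ fun i => k (X i) a := by
    simp only [inner_sum, inner_smul_right, ← hk, real_inner_comm (φ a), dotProduct]
  rw [norm_sub_sq_real, real_inner_smul_left, hcross, norm_smul, mul_pow, Real.norm_eq_abs,
    sq_abs, ← real_inner_self_eq_norm_sq (φ a), hk, regMatrix, add_mulVec, smul_mulVec, one_mulVec,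
    dotProduct_add, dotProduct_smul, hgram, smul_eq_mul]
  ring

lemma norm_sq_add_eq_sq_mul_postVar_add (hk : ∀ a b, ⟪φ a, φ b⟫ = k a b) (hlam : 0 < lam)
    (X : Fin t → A) (a : A) (u : ℝ) (w : Fin t → ℝ) :
    ‖u • φ a - ∑ i, w i • φ (X i)‖ ^ 2 + lam * (w ⬝ᵥ w) =
      u ^ 2 * postVar k lam X a + (w - u • postWeights k lam X a) ⬝ᵥ
        (regMatrix k lam X *ᵥ (w - u • postWeights k lam X a)) := by
  have hS := regMatrix_posDef hk hlam X
  have hp := regMatrix_mulVec_postWeights hk hlam X a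
  have hw : postWeights k lam X a ⬝ᵥ (regMatrix k lam X *ᵥ w) = w ⬝ᵥ fun i => k (X i) a := by
    rw [dotProduct_mulVec, postWeights_vecMul_regMatrix hS.isUnit, dotProduct_comm]
    simp only [← hk, real_inner_comm]
  rw [norm_sq_add_eq_quadratic hk, postVar_eq_sub_postWeights_dotProduct]
  simp only [mulVec_sub, mulVec_smul, hp, dotProduct_sub, sub_dotProduct, smul_dotProduct,
    dotProduct_smul, smul_eq_mul, hw]
  ring

lemma sq_mul_postVar_le_norm_sq_add (hk : ∀ a b, ⟪φ a, φ b⟫ = k a b) (hlam : 0 < lam)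
    (X : Fin t → A) (a : A) (u : ℝ) (w : Fin t → ℝ) :
    u ^ 2 * postVar k lam X a ≤ ‖u • φ a - ∑ i, w i • φ (X i)‖ ^ 2 + lam * (w ⬝ᵥ w) := by
  rw [norm_sq_add_eq_sq_mul_postVar_add hk hlam]
  exact le_add_of_nonneg_right <|
    (regMatrix_posDef hk hlam X).posSemidef.dotProduct_mulVec_nonneg _

lemma postVar_eq_norm_sq_add (hk : ∀ a b, ⟪φ a, φ b⟫ = k a b) (hlam : 0 < lam) (X : Fin t → A)
    (a : A) :
    postVar k lam X a = ‖φ a - ∑ i, postWeights k lam X a i • φ (X i)‖ ^ 2 +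
      lam * (postWeights k lam X a ⬝ᵥ postWeights k lam X a) := by
  simpa using (norm_sq_add_eq_sq_mul_postVar_add hk hlam X a 1 (postWeights k lam X a)).symm

lemma postVar_nonneg (hk : ∀ a b, ⟪φ a, φ b⟫ = k a b) (hlam : 0 < lam) (X : Fin t → A) (a : A) :
    0 ≤ postVar k lam X a := by
  rw [postVar_eq_norm_sq_add hk hlam]
  have := dotProduct_self_star_nonneg (postWeights k lam X a)
  rw [star_trivial] at this
  positivity

lemma postVar_le_prior (hk : ∀ a b, ⟪φ a, φ b⟫ = k a b) (hlam : 0 < lam) (X : Fin t → A) (a : A) :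
    postVar k lam X a ≤ k a a := by
  simpa [← hk] using sq_mul_postVar_le_norm_sq_add hk hlam X a 1 0

/-- `1 / σ²` grows by at most `b / λ`, stated without division because `σ` may vanish. -/
lemma mul_postVar_le_mul_postVar_append (hk : ∀ a b, ⟪φ a, φ b⟫ = k a b) (hlam : 0 < lam)
    (X : Fin t → A) (a : A) (b : ℕ) :
    lam * postVar k lam X a ≤ (lam + b * postVar k lam X a) *
      postVar k lam (Fin.append X fun _ : Fin b => a) a := by
  set v := postVar k lam X a
  set w := postWeights k lam (Fin.append X fun _ : Fin b => a) a
  let u : Fin t → ℝ := fun i => w (Fin.castAdd b i)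
  let c : Fin b → ℝ := fun j => w (Fin.natAdd t j)
  have hv : 0 ≤ v := postVar_nonneg hk hlam X a
  have hmerge : (1 - ∑ j, c j) ^ 2 * v + lam * ∑ j, c j ^ 2 ≤
      postVar k lam (Fin.append X fun _ : Fin b => a) a := by
    have h := sq_mul_postVar_le_norm_sq_add hk hlam X a (1 - ∑ j, c j) u
    rw [postVar_eq_norm_sq_add hk hlam]
    simp only [dotProduct, Fin.sum_univ_add, Fin.append_left, Fin.append_right, ← Finset.sum_smul,
      sub_smul, one_smul, sub_right_comm _ _ (∑ i, _ • φ (X i)), ← sub_sub, ← sq, u] at h ⊢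
    linarith
  have hcauchy : (∑ j, c j) ^ 2 ≤ b * ∑ j, c j ^ 2 := by
    simpa using sq_sum_le_card_mul_sum_sq (s := Finset.univ) (f := c)
  have hsquares : 0 ≤ b * (v * (1 - ∑ j, c j)) ^ 2 -
      2 * (v * (1 - ∑ j, c j)) * (lam * ∑ j, c j) + lam ^ 2 * ∑ j, c j ^ 2 := by
    calc 0 ≤ ∑ j, (v * (1 - ∑ j, c j) - lam * c j) ^ 2 := Finset.sum_nonneg fun _ _ => sq_nonneg _
      _ = _ := by
        simp only [sub_sq, mul_pow lam, Finset.sum_add_distrib, Finset.sum_sub_distrib,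
          Finset.sum_const, Finset.card_univ, Fintype.card_fin, nsmul_eq_mul, ← Finset.mul_sum]
  calc lam * v ≤ (lam + b * v) * ((1 - ∑ j, c j) ^ 2 * v + lam * ∑ j, c j ^ 2) := by
        linarith [mul_le_mul_of_nonneg_left hcauchy (mul_nonneg hlam.le hv)]
    _ ≤ _ := by gcongr

end FeatureMap

section InfoGain

variable {E : Type*} [NormedAddCommGroup E] [InnerProductSpace ℝ E] {k : A → A → ℝ} {φ : A → E}
  {ξ : ℝ}

lemma det_one_add_smul_kernelMatrix (hξ : ξ ≠ 0) {t : ℕ} (X : Fin t → A) :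
    (1 + (ξ ^ 2)⁻¹ • kernelMatrix k X).det = ((ξ ^ 2)⁻¹) ^ t * (regMatrix k (ξ ^ 2) X).det := by
  have hreg : 1 + (ξ ^ 2)⁻¹ • kernelMatrix k X = (ξ ^ 2)⁻¹ • regMatrix k (ξ ^ 2) X := by
    rw [regMatrix, smul_add, inv_smul_smul₀ (pow_ne_zero 2 hξ), add_comm]
  rw [hreg, det_smul, Fintype.card_fin]

lemma infoGain_append (hk : ∀ a b, ⟪φ a, φ b⟫ = k a b) (hξ : ξ ≠ 0) {t : ℕ} (X : Fin t → A)
    (a : A) :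
    infoGain k ξ (Fin.append X fun _ : Fin 1 => a) =
      infoGain k ξ X + 1 / 2 * Real.log (1 + postVar k (ξ ^ 2) X a / ξ ^ 2) := by
  have hlam : 0 < ξ ^ 2 := by positivity
  have hS := regMatrix_posDef hk hlam X
  have hdet := hS.det_pos
  have hv := postVar_nonneg hk hlam X a
  rw [infoGain, infoGain, det_one_add_smul_kernelMatrix hξ, det_one_add_smul_kernelMatrix hξ,
    det_regMatrix_append hS.isUnit, ← mul_add, ← Real.log_mul (by positivity) (by positivity)]
  congr 2
  rw [pow_succ]
  field_simp

lemma infoGain_history_eq_sum (hk : ∀ a b, ⟪φ a, φ b⟫ = k a b) (hξ : ξ ≠ 0) (x : ℕ → A) (T : ℕ) :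
    infoGain k ξ (history x T) = ∑ t ∈ Finset.range T,
      1 / 2 * Real.log (1 + postVar k (ξ ^ 2) (history x t) (x t) / ξ ^ 2) := by
  induction T with
  | zero => simp [infoGain]
  | succ T ih => rw [Finset.sum_range_succ, ← ih, history_succ, infoGain_append hk hξ]

lemma le_mul_log_one_add {z m : ℝ} (hz : 0 ≤ z) (hm : z ≤ m) : z ≤ (1 + m) * Real.log (1 + z) :=
  calc z = (1 + z) * (1 - (1 + z)⁻¹) := by field_simp; ring
    _ ≤ (1 + z) * Real.log (1 + z) := by
      gcongr
      exact Real.one_sub_inv_le_log_of_pos (by positivity)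
    _ ≤ (1 + m) * Real.log (1 + z) := by
      gcongr
      exact Real.log_nonneg (by linarith)

lemma sum_postVar_le [Finite A] (hk : ∀ a b, ⟪φ a, φ b⟫ = k a b) {κ : ℝ}
    (hκ : ∀ a, k a a ≤ κ ^ 2) (hξ : ξ ≠ 0) (x : ℕ → A) (T : ℕ) :
    ∑ t ∈ Finset.range T, postVar k (ξ ^ 2) (history x t) (x t) ≤
      2 * (ξ ^ 2 + κ ^ 2) * maxInfoGain k ξ T := by
  have hlam : 0 < ξ ^ 2 := by positivity
  have hstep (t : ℕ) : postVar k (ξ ^ 2) (history x t) (x t) ≤ 2 * (ξ ^ 2 + κ ^ 2) *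
      (1 / 2 * Real.log (1 + postVar k (ξ ^ 2) (history x t) (x t) / ξ ^ 2)) := by
    have hv := postVar_nonneg hk hlam (history x t) (x t)
    have hvκ := (postVar_le_prior hk hlam (history x t) (x t)).trans (hκ _)
    set v := postVar k (ξ ^ 2) (history x t) (x t)
    calc v = ξ ^ 2 * (v / ξ ^ 2) := by field_simp
      _ ≤ ξ ^ 2 * ((1 + κ ^ 2 / ξ ^ 2) * Real.log (1 + v / ξ ^ 2)) := by
        gcongr
        exact le_mul_log_one_add (by positivity) (by gcongr)
      _ = 2 * (ξ ^ 2 + κ ^ 2) * (1 / 2 * Real.log (1 + v / ξ ^ 2)) := by field_simp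
  calc ∑ t ∈ Finset.range T, postVar k (ξ ^ 2) (history x t) (x t)
      ≤ 2 * (ξ ^ 2 + κ ^ 2) * infoGain k ξ (history x T) := by
        rw [infoGain_history_eq_sum hk hξ, Finset.mul_sum]
        exact Finset.sum_le_sum fun t _ => hstep t
    _ ≤ 2 * (ξ ^ 2 + κ ^ 2) * maxInfoGain k ξ T := by
        gcongr
        exact le_ciSup (f := fun X : Fin T → A => infoGain k ξ X) (Set.finite_range _).bddAbove _

lemma sum_sqrt_postVar_le [Finite A] (hk : ∀ a b, ⟪φ a, φ b⟫ = k a b) {κ : ℝ}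
    (hκ : ∀ a, k a a ≤ κ ^ 2) (hξ : ξ ≠ 0) (x : ℕ → A) (T : ℕ) :
    ∑ t ∈ Finset.range T, √(postVar k (ξ ^ 2) (history x t) (x t)) ≤
      √(2 * (ξ ^ 2 + κ ^ 2)) * √(T * maxInfoGain k ξ T) := by
  calc ∑ t ∈ Finset.range T, √(postVar k (ξ ^ 2) (history x t) (x t))
      ≤ √T * √(∑ t ∈ Finset.range T, postVar k (ξ ^ 2) (history x t) (x t)) := by
        simpa using Real.sum_sqrt_mul_sqrt_le (Finset.range T) (fun _ => zero_le_one)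
          fun t => postVar_nonneg hk (by positivity) (history x t) (x t)
    _ ≤ √T * √(2 * (ξ ^ 2 + κ ^ 2) * maxInfoGain k ξ T) := by
        gcongr
        exact sum_postVar_le hk hκ hξ x T
    _ = √(2 * (ξ ^ 2 + κ ^ 2)) * √(T * maxInfoGain k ξ T) := by
        rw [Real.sqrt_mul (x := 2 * (ξ ^ 2 + κ ^ 2)) (by positivity), Real.sqrt_mul T.cast_nonneg,
          mul_left_comm]

end InfoGain

section Epochs

variable {k : A → A → ℝ} {lam C : ℝ} {x : ℕ → A}

lemma one_le_batchLength (C v : ℝ) : 1 ≤ batchLength C v := by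
  unfold batchLength
  split_ifs
  · exact le_top
  · exact_mod_cast le_max_left _ _

lemma mul_le_of_lt_batchLength {v : ℝ} (hC : 1 ≤ C) (hv : 0 ≤ v) {b : ℕ}
    (hb : b < batchLength C v) : b * v ≤ C ^ 2 - 1 := by
  have hC' : 0 ≤ C ^ 2 - 1 := sub_nonneg.2 (one_le_pow₀ hC)
  rcases hv.eq_or_lt with rfl | hv
  · simpa using hC'
  rw [batchLength, if_neg hv.ne', Nat.cast_lt, lt_max_iff, Nat.lt_one_iff] at hb
  rcases hb with rfl | hb
  · simpa using hC'
  · rw [← le_div_iff₀ hv]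
    exact (Nat.cast_le.2 hb.le).trans (Nat.floor_le (div_nonneg hC' hv.le))

lemma epochStart_succ_cases (k : A → A → ℝ) (lam C : ℝ) (x : ℕ → A) (t : ℕ) :
    epochStart k lam C x (t + 1) = epochStart k lam C x t ∧
        ((t + 1 : ℕ) : ℕ∞) < epochStart k lam C x t + batchLength C
          (postVar k lam (history x (epochStart k lam C x t)) (x (epochStart k lam C x t))) ∨
      epochStart k lam C x (t + 1) = t + 1 := by
  rw [epochStart]
  split_ifs with h
  · exact .inl ⟨rfl, h⟩
  · exact .inr rfl

lemma epochStart_le (k : A → A → ℝ) (lam C : ℝ) (x : ℕ → A) (t : ℕ) :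
    epochStart k lam C x t ≤ t := by
  induction t with
  | zero => rfl
  | succ t ih => rcases epochStart_succ_cases k lam C x t with ⟨h, -⟩ | h <;> omega

lemma epochStart_eq_of_mem {t i : ℕ} (hi : epochStart k lam C x t ≤ i) (hit : i ≤ t) :
    epochStart k lam C x i = epochStart k lam C x t := by
  induction t with
  | zero => rw [Nat.le_zero.1 hit]
  | succ t ih =>
    rcases hit.eq_or_lt with rfl | hit
    · rfl
    rcases epochStart_succ_cases k lam C x t with ⟨h, -⟩ | h
    · rw [h] at hi ⊢
      exact ih hi (Nat.lt_succ_iff.1 hit)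
    · omega

lemma lt_epochStart_add_batchLength (t : ℕ) :
    (t : ℕ∞) < epochStart k lam C x t + batchLength C
      (postVar k lam (history x (epochStart k lam C x t)) (x (epochStart k lam C x t))) := by
  have hfirst {t : ℕ} (ht : epochStart k lam C x t = t) :
      (t : ℕ∞) < epochStart k lam C x t + batchLength C
        (postVar k lam (history x (epochStart k lam C x t)) (x (epochStart k lam C x t))) := by
    rw [ht]
    exact ((ENat.lt_add_one_iff (ENat.natCast_ne_top t)).2 le_rfl).trans_le
      (add_le_add_right (one_le_batchLength _ _) _)
  cases t with
  | zero => exact hfirst rfl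
  | succ t =>
    rcases epochStart_succ_cases k lam C x t with ⟨h, hlt⟩ | h
    · rwa [h]
    · exact hfirst h

lemma postVar_epochStart_le {E : Type*} [NormedAddCommGroup E] [InnerProductSpace ℝ E] {φ : A → E}
    (hk : ∀ a b, ⟪φ a, φ b⟫ = k a b) (hlam : 0 < lam) (hC : 1 ≤ C) {β : ℕ → ℝ} {y : ℕ → ℝ}
    (hrun : IsRun k lam C β x y) (t : ℕ) :
    postVar k lam (history x (epochStart k lam C x t)) (x t) ≤
      C ^ 2 * (1 + 1 / lam) * postVar k lam (history x t) (x t) := by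
  have hx (i : ℕ) (hi : epochStart k lam C x t ≤ i) (hit : i ≤ t) : x i = x t := by
    rw [hrun.repeated i, epochStart_eq_of_mem hi hit, ← hrun.repeated]
  have hB := lt_epochStart_add_batchLength (k := k) (lam := lam) (C := C) (x := x) t
  rw [← hrun.repeated] at hB
  obtain ⟨b, hb⟩ := Nat.exists_eq_add_of_le (epochStart_le k lam C x t)
  generalize epochStart k lam C x t = s at *
  subst hb
  have hrep := mul_postVar_le_mul_postVar_append hk hlam (history x s) (x (s + b)) b
  rw [← history_add_of_repeated fun i hi => hx _ (by omega) (by omega)] at hrep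
  have hv := postVar_nonneg hk hlam (history x s) (x (s + b))
  have hv' := postVar_nonneg hk hlam (history x (s + b)) (x (s + b))
  set v := postVar k lam (history x s) (x (s + b))
  set v' := postVar k lam (history x (s + b)) (x (s + b))
  have hbv : b * v ≤ C ^ 2 - 1 := mul_le_of_lt_batchLength hC hv <| by
    rwa [Nat.cast_add, ENat.add_lt_add_iff_left (ENat.natCast_ne_top s)] at hB
  have hfactor : lam + b * v ≤ C ^ 2 * (lam + 1) := by
    linarith [mul_nonneg (sub_nonneg.2 (one_le_pow₀ hC (n := 2))) hlam.le]
  refine le_of_mul_le_mul_left ?_ hlam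
  calc lam * v ≤ (lam + b * v) * v' := hrep
    _ ≤ C ^ 2 * (lam + 1) * v' := by gcongr
    _ = lam * (C ^ 2 * (1 + 1 / lam) * v') := by field_simp

end Epochs

section Regret

/-- The confidence bounds `|f(a) - μ_t(a)| ≤ β_{t+1} σ_t(a)` hold for all candidates `a` after every
number `t` of steps. -/
def IsConfidenceBand (k : A → A → ℝ) (lam : ℝ) (β : ℕ → ℝ) (f : A → ℝ) (x : ℕ → A) (y : ℕ → ℝ) :
    Prop :=
  ∀ t a, |f a - postMean k lam (history x t) (history y t) a| ≤
    β (t + 1) * √(postVar k lam (history x t) a)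

lemma ciSup_sub_le_two_mul {ι : Type*} [Nonempty ι] {f m w : ι → ℝ} (hf : ∀ i, |f i - m i| ≤ w i)
    {i : ι} (hi : ∀ j, m j + w j ≤ m i + w i) : (⨆ j, f j) - f i ≤ 2 * w i := by
  rw [sub_le_iff_le_add]
  refine ciSup_le fun j => ?_
  linarith [hi j, (abs_le.1 (hf j)).2, (abs_le.1 (hf i)).1]

variable [Nonempty A] {k : A → A → ℝ} {lam C : ℝ} {β : ℕ → ℝ} {f : A → ℝ} {x : ℕ → A} {y : ℕ → ℝ}

lemma ciSup_sub_le_epochStart (hrun : IsRun k lam C β x y)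
    (hconf : IsConfidenceBand k lam β f x y) (t : ℕ) :
    (⨆ a, f a) - f (x t) ≤ 2 * (β (epochStart k lam C x t + 1) *
      √(postVar k lam (history x (epochStart k lam C x t)) (x t))) := by
  have hstart := epochStart_eq_of_mem le_rfl (epochStart_le k lam C x t)
  rw [hrun.repeated t]
  exact ciSup_sub_le_two_mul (hconf _) (hrun.select _ hstart)

variable {E : Type*} [NormedAddCommGroup E] [InnerProductSpace ℝ E] {φ : A → E}

lemma ciSup_sub_le_mul_sqrt_postVar (hk : ∀ a b, ⟪φ a, φ b⟫ = k a b) (hlam : 0 < lam) (hC : 1 ≤ C)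
    (hβ : Monotone β) (hβ0 : ∀ t, 0 ≤ β t) (hrun : IsRun k lam C β x y)
    (hconf : IsConfidenceBand k lam β f x y) (t : ℕ) :
    (⨆ a, f a) - f (x t) ≤
      2 * β (t + 1) * (C * √(1 + 1 / lam)) * √(postVar k lam (history x t) (x t)) := by
  have hsqrt : √(postVar k lam (history x (epochStart k lam C x t)) (x t)) ≤
      C * √(1 + 1 / lam) * √(postVar k lam (history x t) (x t)) := by
    refine (Real.sqrt_le_sqrt (postVar_epochStart_le hk hlam hC hrun t)).trans_eq ?_
    rw [Real.sqrt_mul (by positivity), Real.sqrt_mul (by positivity), Real.sqrt_sq (by linarith)]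
  calc (⨆ a, f a) - f (x t) ≤ _ := ciSup_sub_le_epochStart hrun hconf t
    _ ≤ 2 * (β (t + 1) * (C * √(1 + 1 / lam) * √(postVar k lam (history x t) (x t)))) := by
      gcongr
      · exact hβ0 _
      · exact hβ (by simpa using epochStart_le k lam C x t)
    _ = _ := by ring

lemma regret_le_of_isConfidenceBand [Finite A] (hk : ∀ a b, ⟪φ a, φ b⟫ = k a b) {κ ξ : ℝ}
    (hκ : ∀ a, k a a ≤ κ ^ 2) (hξ : ξ ≠ 0) (hC : 1 ≤ C) (hβ : Monotone β) (hβ0 : ∀ t, 0 ≤ β t)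
    (hrun : IsRun k (ξ ^ 2) C β x y) (hconf : IsConfidenceBand k (ξ ^ 2) β f x y) (T : ℕ) :
    regret f x T ≤ 2 * √(2 * (1 + 1 / ξ ^ 2) * (ξ ^ 2 + κ ^ 2)) * β T *
      (C * √(T * maxInfoGain k ξ T)) := by
  have hβT := hβ0 T
  calc regret f x T ≤ ∑ t ∈ Finset.range T,
        2 * β T * (C * √(1 + 1 / ξ ^ 2)) * √(postVar k (ξ ^ 2) (history x t) (x t)) := by
        refine Finset.sum_le_sum fun t ht => (ciSup_sub_le_mul_sqrt_postVar hk (by positivity) hC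
          hβ hβ0 hrun hconf t).trans ?_
        gcongr
        exact hβ (Finset.mem_range.1 ht)
    _ = 2 * β T * (C * √(1 + 1 / ξ ^ 2)) *
          ∑ t ∈ Finset.range T, √(postVar k (ξ ^ 2) (history x t) (x t)) :=
        (Finset.mul_sum _ _ _).symm
    _ ≤ 2 * β T * (C * √(1 + 1 / ξ ^ 2)) *
          (√(2 * (ξ ^ 2 + κ ^ 2)) * √(T * maxInfoGain k ξ T)) := by
        gcongr
        exact sum_sqrt_postVar_le hk hκ hξ x T
    _ = _ := by
        rw [mul_comm 2 (1 + 1 / ξ ^ 2), mul_assoc (1 + 1 / ξ ^ 2),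
          Real.sqrt_mul (x := 1 + 1 / ξ ^ 2) (by positivity)]
        ring

end Regret

section BetaBayes

variable {n : ℕ} {δ : ℝ}

lemma monotone_betaBayes (n : ℕ) (hδ : 0 < δ) : Monotone (betaBayes n δ) := by
  intro s t hst
  rcases (show 0 ≤ (n : ℝ) * s ^ 2 * Real.pi ^ 2 / (6 * δ) by positivity).eq_or_lt with hs | hs
  · rw [betaBayes, ← hs]
    simp [betaBayes]
  · unfold betaBayes
    gcongr

lemma betaBayes_le (hn : 0 < n) (hδ : 0 < δ) (hδ' : δ ≤ 1) {T : ℕ} (hT : 1 ≤ T) :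
    betaBayes n δ T ≤ 2 * (1 + Real.log (n * T / δ)) := by
  have hn' : (1 : ℝ) ≤ n := Nat.one_le_cast.2 hn
  have hT' : (1 : ℝ) ≤ T := Nat.one_le_cast.2 hT
  have hTz : T ≤ n * T / δ := by
    rw [mul_div_right_comm]
    exact le_mul_of_one_le_left (by positivity) ((one_le_div hδ).2 (hδ'.trans hn'))
  have hpi : Real.pi ^ 2 / 6 ≤ Real.exp 1 := by
    nlinarith [Real.pi_lt_d2, Real.pi_pos, Real.exp_one_gt_d9]
  have hlog : Real.log (n * T ^ 2 * Real.pi ^ 2 / (6 * δ)) ≤ 2 * Real.log (n * T / δ) + 1 := by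
    calc Real.log (n * T ^ 2 * Real.pi ^ 2 / (6 * δ))
        = Real.log (n * T / δ * T * (Real.pi ^ 2 / 6)) := by congr 1; field_simp
      _ ≤ Real.log (n * T / δ * (n * T / δ) * Real.exp 1) := by gcongr
      _ = 2 * Real.log (n * T / δ) + 1 := by
        rw [Real.log_mul (by positivity) (by positivity), Real.log_exp, ← sq, Real.log_pow,
          Nat.cast_two]
  have hlog0 : 0 ≤ Real.log (n * T / δ) := Real.log_nonneg (hT'.trans hTz)
  rw [betaBayes, Real.sqrt_le_left (by positivity)]
  nlinarith

lemma card_mul_exp_betaBayes (hn : 0 < n) (hδ : 0 < δ) (hδ' : δ ≤ 1) {t : ℕ} (ht : 1 ≤ t) :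
    n * Real.exp (-(betaBayes n δ t ^ 2 / 2)) = δ * (6 / Real.pi ^ 2) * (1 / (t : ℝ) ^ 2) := by
  have hn' : (1 : ℝ) ≤ n := Nat.one_le_cast.2 hn
  have ht' : (1 : ℝ) ≤ t := Nat.one_le_cast.2 ht
  have hpi : 6 ≤ Real.pi ^ 2 := by nlinarith [Real.pi_gt_three]
  have hone : 1 ≤ n * (t : ℝ) ^ 2 * Real.pi ^ 2 / (6 * δ) := by
    rw [one_le_div (by positivity)]
    calc 6 * δ ≤ 1 * 1 ^ 2 * Real.pi ^ 2 := by linarith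
      _ ≤ n * (t : ℝ) ^ 2 * Real.pi ^ 2 := by gcongr
  rw [betaBayes, Real.sq_sqrt (mul_nonneg zero_le_two (Real.log_nonneg hone)),
    mul_div_cancel_left₀ _ two_ne_zero, Real.exp_neg, Real.exp_log (by positivity)]
  field_simp

lemma hasSum_card_mul_exp_betaBayes (hn : 0 < n) (hδ : 0 < δ) (hδ' : δ ≤ 1) :
    HasSum (fun t => n * Real.exp (-(betaBayes n δ (t + 1) ^ 2 / 2))) δ := by
  have hzeta : HasSum (fun t : ℕ => 1 / ((t + 1 : ℕ) : ℝ) ^ 2) (Real.pi ^ 2 / 6) := by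
    simpa using (hasSum_nat_add_iff' 1).2 hasSum_zeta_two
  have hsum : HasSum (fun t : ℕ => δ * (6 / Real.pi ^ 2) * (1 / ((t + 1 : ℕ) : ℝ) ^ 2))
      (δ * (6 / Real.pi ^ 2) * (Real.pi ^ 2 / 6)) := hzeta.mul_left _
  have hδπ : δ * (6 / Real.pi ^ 2) * (Real.pi ^ 2 / 6) = δ := by field_simp
  rw [hδπ] at hsum
  simpa only [card_mul_exp_betaBayes hn hδ hδ' (Nat.le_add_left 1 _)] using hsum

end BetaBayes

open scoped NNReal ENNReal

section GaussianTail

variable {v : ℝ≥0} {b c : ℝ}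

lemma gaussianPDF_zero_add_le {z : ℝ} (hc : 0 ≤ c) (hz : 0 ≤ z) :
    gaussianPDF 0 v (z + c) ≤
      ENNReal.ofReal (Real.exp (-(c ^ 2 / (2 * v)))) * gaussianPDF 0 v z := by
  have hexponent : -(z + c - 0) ^ 2 / (2 * v) ≤ -(c ^ 2 / (2 * v)) + -(z - 0) ^ 2 / (2 * v) := by
    rw [← neg_div, ← add_div]
    gcongr
    linarith [mul_nonneg hz hc]
  rw [gaussianPDF, gaussianPDF, ← ENNReal.ofReal_mul (Real.exp_nonneg _), gaussianPDFReal,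
    gaussianPDFReal, mul_left_comm, ← Real.exp_add]
  gcongr

lemma gaussianReal_Ioi_le (hv : v ≠ 0) (hc : 0 ≤ c) :
    gaussianReal 0 v (Set.Ioi c) ≤
      ENNReal.ofReal (Real.exp (-(c ^ 2 / (2 * v)))) * gaussianReal 0 v (Set.Ioi 0) := by
  rw [gaussianReal_apply _ hv, gaussianReal_apply _ hv,
    ← lintegral_const_mul _ (measurable_gaussianPDF 0 v),
    ← (measurePreserving_add_right volume c).setLIntegral_comp_preimage measurableSet_Ioi
      (measurable_gaussianPDF 0 v), Set.preimage_add_const_Ioi, sub_self]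
  exact setLIntegral_mono' measurableSet_Ioi fun z hz => gaussianPDF_zero_add_le hc hz.le

lemma gaussianReal_Iio_neg (v : ℝ≥0) (c : ℝ) :
    gaussianReal 0 v (Set.Iio (-c)) = gaussianReal 0 v (Set.Ioi c) := by
  have hmap : (gaussianReal 0 v).map (fun z => -z) = gaussianReal 0 v := by
    rw [gaussianReal_map_neg, neg_zero]
  conv_lhs => rw [← hmap, Measure.map_apply measurable_neg measurableSet_Iio]
  simp

lemma gaussianReal_lt_abs_le (hv : v ≠ 0) (hc : 0 ≤ c) :
    gaussianReal 0 v {z | c < |z|} ≤ ENNReal.ofReal (Real.exp (-(c ^ 2 / (2 * v)))) := by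
  have hset : {z : ℝ | c < |z|} = Set.Iio (-c) ∪ Set.Ioi c := by
    ext z
    simp [lt_abs, lt_neg, or_comm]
  have hhalves : gaussianReal 0 v (Set.Ioi 0) + gaussianReal 0 v (Set.Ioi 0) ≤ 1 := by
    nth_rewrite 1 [← gaussianReal_Iio_neg, neg_zero]
    rw [← measure_union ((Set.Iio_disjoint_Ici le_rfl).mono_right Set.Ioi_subset_Ici_self)
      measurableSet_Ioi]
    exact prob_le_one
  calc gaussianReal 0 v {z | c < |z|}
      ≤ gaussianReal 0 v (Set.Iio (-c)) + gaussianReal 0 v (Set.Ioi c) := by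
        rw [hset]
        exact measure_union_le _ _
    _ ≤ ENNReal.ofReal (Real.exp (-(c ^ 2 / (2 * v)))) *
          (gaussianReal 0 v (Set.Ioi 0) + gaussianReal 0 v (Set.Ioi 0)) := by
        rw [gaussianReal_Iio_neg, mul_add]
        exact add_le_add (gaussianReal_Ioi_le hv hc) (gaussianReal_Ioi_le hv hc)
    _ ≤ _ := mul_le_of_le_one_right' hhalves

lemma gaussianReal_mul_sqrt_lt_abs_le (v : ℝ≥0) (hb : 0 ≤ b) :
    gaussianReal 0 v {z | b * √v < |z|} ≤ ENNReal.ofReal (Real.exp (-(b ^ 2 / 2))) := by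
  rcases eq_or_ne v 0 with rfl | hv
  · rw [gaussianReal_zero_var, Measure.dirac_apply' _
      (measurableSet_lt measurable_const measurable_abs)]
    simp
  · have hexponent : (b * √v) ^ 2 / (2 * v) = b ^ 2 / 2 := by
      rw [mul_pow, Real.sq_sqrt v.coe_nonneg]
      field_simp
    rw [← hexponent]
    exact gaussianReal_lt_abs_le hv (by positivity)

end GaussianTail

section Feedback

variable {Ω : Type*}

/-- The feedback of evaluating the candidates in the fixed sequence `X`. -/
def feedback (f : A → Ω → ℝ) (η : ℕ → Ω → ℝ) {t : ℕ} (X : Fin t → A) (i : Fin t) (ω : Ω) : ℝ :=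
  f (X i) ω + η i ω

/-- The error at `a` of the posterior mean after evaluating the candidates in the fixed
sequence `X`. -/
def postError (k : A → A → ℝ) (lam : ℝ) (f : A → Ω → ℝ) (η : ℕ → Ω → ℝ) {t : ℕ} (X : Fin t → A)
    (a : A) (ω : Ω) : ℝ :=
  f a ω - postMean k lam X (fun i => feedback f η X i ω) a

lemma postError_eq (k : A → A → ℝ) (lam : ℝ) (f : A → Ω → ℝ) (η : ℕ → Ω → ℝ) {t : ℕ}
    (X : Fin t → A) (a : A) :
    postError k lam f η X a = f a - ∑ i, postWeights k lam X a i • feedback f η X i := by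
  funext ω
  simp [postError, postMean_eq_postWeights_dotProduct, dotProduct]

end Feedback

variable {Ω : Type*} [MeasurableSpace Ω] {P : Measure Ω}

lemma measure_iUnion_inter_le [IsProbabilityMeasure P] {ι : Type*} [Countable ι] {s B : ι → Set Ω}
    {ε : ℝ≥0∞} (hs : ∀ i, NullMeasurableSet (s i) P) (hdisj : Pairwise (Function.onFun Disjoint s))
    (hindep : ∀ i, P (s i ∩ B i) = P (s i) * P (B i)) (hB : ∀ i, P (B i) ≤ ε) :
    P (⋃ i, s i ∩ B i) ≤ ε :=
  calc P (⋃ i, s i ∩ B i) ≤ ∑' i, P (s i ∩ B i) := measure_iUnion_le _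
    _ ≤ ∑' i, P (s i) * ε := ENNReal.tsum_le_tsum fun i => by
      rw [hindep]
      gcongr
      exact hB i
    _ = P (⋃ i, s i) * ε := by
      rw [ENNReal.tsum_mul_right, measure_iUnion₀ (fun i j hij => (hdisj hij).aedisjoint) hs]
    _ ≤ ε := mul_le_of_le_one_left' prob_le_one

section Selection

/-- The first `t` candidates that the decision rule `sel` picks if the feedback of the first `t`
steps is `u`. -/
def selected (sel : (t : ℕ) → (Fin t → ℝ) → A) {t : ℕ} (u : Fin t → ℝ) (i : Fin t) : A :=
  sel i fun j => u (Fin.castLE i.isLt.le j)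

variable {sel : (t : ℕ) → (Fin t → ℝ) → A}

lemma measurableSet_preimage_selected (hsel : ∀ t a, MeasurableSet (sel t ⁻¹' {a})) {t : ℕ}
    (X : Fin t → A) : MeasurableSet (selected sel ⁻¹' {X}) := by
  have hpreimage : selected sel ⁻¹' {X} =
      ⋂ i : Fin t, (fun u j => u (Fin.castLE i.isLt.le j)) ⁻¹' (sel i ⁻¹' {X i}) := by
    ext u
    simp [selected, funext_iff]
  rw [hpreimage]
  exact .iInter fun i => measurable_pi_lambda _ (fun _ => measurable_pi_apply _) (hsel i (X i))

lemma selected_eq_iff_history_eq {x : ℕ → A} {y : ℕ → ℝ} {F : ℕ → A → ℝ}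
    (hx : ∀ t, x t = sel t (history y t)) (hy : ∀ t, y t = F t (x t)) {t : ℕ} (X : Fin t → A) :
    selected sel (fun i => F i (X i)) = X ↔ history x t = X := by
  constructor
  · intro h
    have hX (s : ℕ) (hs : s < t) : x s = X ⟨s, hs⟩ := by
      induction s using Nat.strong_induction_on with
      | _ s ih =>
        rw [hx, ← congrFun h ⟨s, hs⟩]
        refine congrArg (sel s) (funext fun j => ?_)
        rw [history, hy, ih j j.isLt (j.isLt.trans hs)]
        rfl
    exact funext fun i => hX i i.isLt
  · rintro rfl
    funext i
    simp only [selected, history, hx i, ← hy, Fin.val_castLE]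

end Selection

section Probability

variable {k : A → A → ℝ} {f : A → Ω → ℝ} {η : ℕ → Ω → ℝ} {ξ lam : ℝ} {t : ℕ}
  {X : Fin t → A}

lemma IsCenteredGP.memLp (hf : IsCenteredGP k f P) (a : A) : MemLp (f a) 2 P :=
  (hf.gaussian.hasGaussianLaw_eval a).memLp_two

lemma IsCenteredGP.symm (hf : IsCenteredGP k f P) (a b : A) : k a b = k b a := by
  rw [← hf.cov_eq, ← hf.cov_eq, covariance_comm]

lemma IsCenteredGP.hasGaussianLaw_comp (hf : IsCenteredGP k f P) {ι : Type*} [Finite ι]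
    (p : ι → A) : HasGaussianLaw (fun ω i => f (p i) ω) P := by
  classical
  cases nonempty_fintype ι
  let L : (Finset.univ.image p → ℝ) →L[ℝ] (ι → ℝ) := .pi fun i =>
    .proj ⟨p i, Finset.mem_image_of_mem p (Finset.mem_univ i)⟩
  exact (hf.gaussian.hasGaussianLaw (Finset.univ.image p)).map L

namespace IsGaussianNoise

variable (hη : IsGaussianNoise ξ f η P)
include hη

lemma memLp (t : ℕ) : MemLp (η t) 2 P :=
  (hη.law t).hasGaussianLaw.memLp_two

lemma cov_eq (s t : ℕ) : cov[η s, η t; P] = if s = t then ξ ^ 2 else 0 := by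
  split_ifs with h
  · rw [h, covariance_self (hη.law t).aemeasurable, (hη.law t).variance_eq,
      variance_id_gaussianReal, Real.coe_toNNReal _ (sq_nonneg ξ)]
  · exact (hη.iIndep.indepFun h).covariance_eq_zero (hη.memLp s) (hη.memLp t)

variable (hf : IsCenteredGP k f P)
include hf

lemma cov_prior_noise (a : A) (t : ℕ) : cov[f a, η t; P] = 0 :=
  (hη.indep.comp (measurable_pi_apply a) (measurable_pi_apply t)).covariance_eq_zero
    (hf.memLp a) (hη.memLp t)

lemma memLp_feedback (X : Fin t → A) (i : Fin t) : MemLp (feedback f η X i) 2 P :=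
  (hf.memLp (X i)).add (hη.memLp i)

lemma memLp_postError (X : Fin t → A) (a : A) : MemLp (postError k lam f η X a) 2 P := by
  rw [postError_eq]
  exact (hf.memLp a).sub (memLp_finsetSum' _ fun i _ => (hη.memLp_feedback hf X i).const_smul _)

lemma hasGaussianLaw_prior_noise {ι : Type*} [Finite ι] (p : ι → A) (t : ℕ) :
    HasGaussianLaw (fun ω => (fun i => f (p i) ω, fun i : Fin t => η i ω)) P := by
  cases nonempty_fintype ι
  have hnoise : HasGaussianLaw (fun ω (i : Fin t) => η i ω) P :=
    (hη.iIndep.precomp Fin.val_injective).hasGaussianLaw fun i => (hη.law i).hasGaussianLaw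
  have hindep : IndepFun (fun ω i => f (p i) ω) (fun ω (i : Fin t) => η i ω) P :=
    hη.indep.comp (φ := fun (g : A → ℝ) i => g (p i)) (ψ := fun (e : ℕ → ℝ) (i : Fin t) => e i)
      (measurable_pi_lambda _ fun i => measurable_pi_apply (p i))
      (measurable_pi_lambda _ fun i => measurable_pi_apply (i : ℕ))
  exact hindep.hasGaussianLaw (hf.hasGaussianLaw_comp p) hnoise

lemma hasGaussianLaw_feedback_postError (lam : ℝ) (X : Fin t → A) (a : A) :
    HasGaussianLaw (fun ω => (fun i => feedback f η X i ω,
      fun _ : Unit => postError k lam f η X a ω)) P := by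
  let value (i : Option (Fin t)) : (Option (Fin t) → ℝ) × (Fin t → ℝ) →L[ℝ] ℝ :=
    (ContinuousLinearMap.proj i).comp (.fst ℝ _ _)
  let evaluate (i : Fin t) : (Option (Fin t) → ℝ) × (Fin t → ℝ) →L[ℝ] ℝ :=
    value (some i) + (ContinuousLinearMap.proj i).comp (.snd ℝ _ _)
  let error : (Option (Fin t) → ℝ) × (Fin t → ℝ) →L[ℝ] ℝ :=
    value none - ∑ i, postWeights k lam X a i • evaluate i
  convert! (hη.hasGaussianLaw_prior_noise hf (fun i => i.elim a X) t).map_fun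
    ((ContinuousLinearMap.pi evaluate).prod (.pi fun _ : Unit => error)) using 2
  simp [postError_eq, feedback, value, evaluate, error, mul_add]

variable [IsProbabilityMeasure P]

lemma cov_prior_feedback (X : Fin t → A) (a : A) (i : Fin t) :
    cov[f a, feedback f η X i; P] = k a (X i) := by
  change cov[f a, f (X i) + η i; P] = _
  rw [covariance_add_right (hf.memLp _) (hf.memLp _) (hη.memLp _), hf.cov_eq,
    hη.cov_prior_noise hf, add_zero]

lemma cov_feedback (X : Fin t → A) (i j : Fin t) :
    cov[feedback f η X i, feedback f η X j; P] = regMatrix k (ξ ^ 2) X i j := by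
  change cov[f (X i) + η i, feedback f η X j; P] = _
  rw [covariance_add_left (hf.memLp _) (hη.memLp _) (hη.memLp_feedback hf X j),
    hη.cov_prior_feedback hf]
  change _ + cov[η i, f (X j) + η j; P] = _
  rw [covariance_add_right (hη.memLp _) (hf.memLp _) (hη.memLp _), covariance_comm (η i),
    hη.cov_prior_noise hf, hη.cov_eq]
  simp [regMatrix, kernelMatrix, Matrix.one_apply, Fin.ext_iff]

lemma cov_postError (lam : ℝ) (X : Fin t → A) (a : A) {Y : Ω → ℝ} (hY : MemLp Y 2 P) :
    cov[postError k lam f η X a, Y; P] =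
      cov[f a, Y; P] - ∑ i, postWeights k lam X a i * cov[feedback f η X i, Y; P] := by
  have hweighted (i : Fin t) : MemLp (postWeights k lam X a i • feedback f η X i) 2 P :=
    (hη.memLp_feedback hf X i).const_smul _
  rw [postError_eq, covariance_sub_left (hf.memLp a) (memLp_finsetSum' _ fun i _ => hweighted i) hY,
    covariance_sum_left hweighted hY]
  simp only [covariance_smul_left]

lemma integral_feedback (X : Fin t → A) (i : Fin t) : ∫ ω, feedback f η X i ω ∂P = 0 := by
  simp only [feedback]
  rw [integral_add ((hf.memLp _).integrable one_le_two) ((hη.memLp _).integrable one_le_two),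
    hf.mean_zero, (hη.law i).integral_eq, integral_id_gaussianReal, add_zero]

lemma integral_postError (lam : ℝ) (X : Fin t → A) (a : A) :
    ∫ ω, postError k lam f η X a ω ∂P = 0 := by
  have hweighted (i : Fin t) :
      Integrable (fun ω => postWeights k lam X a i * feedback f η X i ω) P :=
    ((hη.memLp_feedback hf X i).integrable one_le_two).const_mul _
  simp only [postError_eq, Pi.sub_apply, Finset.sum_apply, Pi.smul_apply, smul_eq_mul]
  rw [integral_sub ((hf.memLp a).integrable one_le_two) (integrable_finsetSum _ fun i _ =>
    hweighted i), integral_finsetSum _ fun i _ => hweighted i]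
  simp only [integral_const_mul, hη.integral_feedback hf, hf.mean_zero, mul_zero,
    Finset.sum_const_zero, sub_zero]

lemma cov_postError_feedback (hX : IsUnit (regMatrix k (ξ ^ 2) X)) (a : A) (i : Fin t) :
    cov[postError k (ξ ^ 2) f η X a, feedback f η X i; P] = 0 := by
  rw [hη.cov_postError hf _ X a (hη.memLp_feedback hf X i), hη.cov_prior_feedback hf]
  simp only [hη.cov_feedback hf]
  exact sub_eq_zero.2 (congrFun (postWeights_vecMul_regMatrix hX a) i).symm

lemma variance_postError (hX : IsUnit (regMatrix k (ξ ^ 2) X)) (a : A) :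
    Var[postError k (ξ ^ 2) f η X a; P] = postVar k (ξ ^ 2) X a := by
  have herror := hη.memLp_postError hf (lam := ξ ^ 2) X a
  rw [← covariance_self herror.aemeasurable, hη.cov_postError hf _ X a herror,
    covariance_comm (f a), hη.cov_postError hf _ X a (hf.memLp a), hf.cov_eq,
    postVar_eq_sub_postWeights_dotProduct]
  simp only [covariance_comm _ (postError k (ξ ^ 2) f η X a), hη.cov_postError_feedback hf hX,
    covariance_comm _ (f a), hη.cov_prior_feedback hf, mul_zero, Finset.sum_const_zero, sub_zero,
    dotProduct, hf.symm a]

lemma indepFun_feedback_postError (hX : IsUnit (regMatrix k (ξ ^ 2) X)) (a : A) :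
    IndepFun (fun ω i => feedback f η X i ω) (postError k (ξ ^ 2) f η X a) P :=
  ((hη.hasGaussianLaw_feedback_postError hf (ξ ^ 2) X a).indepFun_of_covariance_eval
    fun i _ => (covariance_comm _ _).trans (hη.cov_postError_feedback hf hX a i)).comp
      measurable_id (measurable_pi_apply ())

end IsGaussianNoise

variable [IsProbabilityMeasure P]

lemma IsCenteredGP.inner_toLp (hf : IsCenteredGP k f P) (a b : A) :
    ⟪(hf.memLp a).toLp (f a), (hf.memLp b).toLp (f b)⟫ = k a b := by
  rw [← hf.cov_eq, covariance_eq_sub (hf.memLp a) (hf.memLp b), hf.mean_zero, zero_mul, sub_zero,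
    L2.inner_def]
  refine integral_congr_ae ?_
  filter_upwards [(hf.memLp a).coeFn_toLp, (hf.memLp b).coeFn_toLp] with ω ha hb
  simp [ha, hb, mul_comm]

lemma IsCenteredGP.isUnit_regMatrix (hf : IsCenteredGP k f P) (hlam : 0 < lam) (X : Fin t → A) :
    IsUnit (regMatrix k lam X) :=
  (regMatrix_posDef hf.inner_toLp hlam X).isUnit

lemma IsGaussianNoise.measure_mul_sqrt_postVar_lt_abs_postError_le (hη : IsGaussianNoise ξ f η P)
    (hf : IsCenteredGP k f P) (hξ : ξ ≠ 0) (X : Fin t → A) (a : A) {b : ℝ} (hb : 0 ≤ b) :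
    P {ω | b * √(postVar k (ξ ^ 2) X a) < |postError k (ξ ^ 2) f η X a ω|} ≤
      ENNReal.ofReal (Real.exp (-(b ^ 2 / 2))) := by
  have hlam : 0 < ξ ^ 2 := by positivity
  have hlaw : HasGaussianLaw (postError k (ξ ^ 2) f η X a) P :=
    (hη.hasGaussianLaw_feedback_postError hf (ξ ^ 2) X a).snd.eval ()
  have hmap := hlaw.map_eq_gaussianReal
  rw [hη.integral_postError hf, hη.variance_postError hf (hf.isUnit_regMatrix hlam X)] at hmap
  have htail := gaussianReal_mul_sqrt_lt_abs_le (postVar k (ξ ^ 2) X a).toNNReal hb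
  rwa [← hmap, Measure.map_apply_of_aemeasurable hlaw.aemeasurable
    (measurableSet_lt measurable_const measurable_abs),
    Real.coe_toNNReal _ (postVar_nonneg hf.inner_toLp hlam X a)] at htail

section AdaptiveSelection

variable (hη : IsGaussianNoise ξ f η P) (hf : IsCenteredGP k f P) (hξ : ξ ≠ 0)
  {sel : (t : ℕ) → (Fin t → ℝ) → A} (hsel : ∀ t a, MeasurableSet (sel t ⁻¹' {a}))
  {x : ℕ → Ω → A} {y : ℕ → Ω → ℝ} (hx : ∀ t ω, x t ω = sel t (fun i => y i ω))
  (hy : ∀ t ω, y t ω = f (x t ω) ω + η t ω)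
include hη hf hξ hsel hx hy

lemma measure_mul_sqrt_postVar_lt_abs_sub_postMean_le [Countable A] (t : ℕ) (a : A) {b : ℝ}
    (hb : 0 ≤ b) :
    P {ω | b * √(postVar k (ξ ^ 2) (history (x · ω) t) a) <
        |f a ω - postMean k (ξ ^ 2) (history (x · ω) t) (history (y · ω) t) a|} ≤
      ENNReal.ofReal (Real.exp (-(b ^ 2 / 2))) := by
  let chosen (X : Fin t → A) : Set Ω :=
    (fun ω i => feedback f η X i ω) ⁻¹' (selected sel ⁻¹' {X})
  let bad (X : Fin t → A) : Set Ω :=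
    {ω | b * √(postVar k (ξ ^ 2) X a) < |postError k (ξ ^ 2) f η X a ω|}
  have mem_chosen (X : Fin t → A) (ω : Ω) : ω ∈ chosen X ↔ history (x · ω) t = X :=
    selected_eq_iff_history_eq (F := fun t a => f a ω + η t ω) (hx · ω) (hy · ω) X
  have hsub : {ω | b * √(postVar k (ξ ^ 2) (history (x · ω) t) a) <
        |f a ω - postMean k (ξ ^ 2) (history (x · ω) t) (history (y · ω) t) a|} ⊆
      ⋃ X, chosen X ∩ bad X := by
    intro ω hω
    have hfeedback : history (y · ω) t = fun i => feedback f η (history (x · ω) t) i ω :=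
      funext fun i => hy i ω
    rw [Set.mem_ofPred_eq, hfeedback] at hω
    exact Set.mem_iUnion.2 ⟨history (x · ω) t, (mem_chosen _ ω).2 rfl, hω⟩
  have hdisj : Pairwise (Function.onFun Disjoint chosen) := fun X Y hXY =>
    Set.disjoint_left.2 fun ω hωX hωY =>
      hXY (((mem_chosen X ω).1 hωX).symm.trans ((mem_chosen Y ω).1 hωY))
  have hlam : 0 < ξ ^ 2 := by positivity
  refine (measure_mono hsub).trans (measure_iUnion_inter_le (fun X => ?_) hdisj (fun X => ?_)
    fun X => hη.measure_mul_sqrt_postVar_lt_abs_postError_le hf hξ X a hb)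
  · exact (aemeasurable_pi_lambda _ fun i => (hη.memLp_feedback hf X i).aemeasurable).nullMeasurable
      (measurableSet_preimage_selected hsel X)
  · exact (hη.indepFun_feedback_postError hf (hf.isUnit_regMatrix hlam X) a)
      |>.measure_inter_preimage_eq_mul _ _ (measurableSet_preimage_selected hsel X)
        (measurableSet_lt measurable_const measurable_abs)

lemma measure_not_isConfidenceBand_le [Fintype A] {β : ℕ → ℝ} (hβ : ∀ t, 0 ≤ β t) :
    P {ω | ¬ IsConfidenceBand k (ξ ^ 2) β (f · ω) (x · ω) (y · ω)} ≤
      ∑' t, Fintype.card A * ENNReal.ofReal (Real.exp (-(β (t + 1) ^ 2 / 2))) := by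
  have hsub : {ω | ¬ IsConfidenceBand k (ξ ^ 2) β (f · ω) (x · ω) (y · ω)} ⊆
      ⋃ t, ⋃ a, {ω | β (t + 1) * √(postVar k (ξ ^ 2) (history (x · ω) t) a) <
        |f a ω - postMean k (ξ ^ 2) (history (x · ω) t) (history (y · ω) t) a|} := fun ω hω => by
    simpa [IsConfidenceBand] using hω
  calc P {ω | ¬ IsConfidenceBand k (ξ ^ 2) β (f · ω) (x · ω) (y · ω)}
      ≤ ∑' t, ∑' a, P {ω | β (t + 1) * √(postVar k (ξ ^ 2) (history (x · ω) t) a) <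
          |f a ω - postMean k (ξ ^ 2) (history (x · ω) t) (history (y · ω) t) a|} :=
        (measure_mono hsub).trans <| (measure_iUnion_le _).trans <|
          ENNReal.tsum_le_tsum fun t => measure_iUnion_le _
    _ ≤ ∑' t, ∑' _ : A, ENNReal.ofReal (Real.exp (-(β (t + 1) ^ 2 / 2))) :=
        ENNReal.tsum_le_tsum fun t => ENNReal.tsum_le_tsum fun a =>
          measure_mul_sqrt_postVar_lt_abs_sub_postMean_le hη hf hξ hsel hx hy t a (hβ (t + 1))
    _ = _ := by simp only [tsum_fintype, Finset.sum_const, Finset.card_univ, nsmul_eq_mul]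

lemma ofReal_one_sub_le_measure_isConfidenceBand [Fintype A] [Nonempty A] {δ : ℝ} (hδ : 0 < δ)
    (hδ' : δ ≤ 1) :
    ENNReal.ofReal (1 - δ) ≤ P {ω | IsConfidenceBand k (ξ ^ 2) (betaBayes (Fintype.card A) δ)
      (f · ω) (x · ω) (y · ω)} := by
  have hsum : ENNReal.ofReal δ = ∑' t, Fintype.card A *
      ENNReal.ofReal (Real.exp (-(betaBayes (Fintype.card A) δ (t + 1) ^ 2 / 2))) := by
    have hreal := hasSum_card_mul_exp_betaBayes (Fintype.card_pos (α := A)) hδ hδ'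
    conv_lhs => rw [← hreal.tsum_eq]
    rw [ENNReal.ofReal_tsum_of_nonneg (fun t => by positivity) hreal.summable]
    simp only [ENNReal.ofReal_mul (Nat.cast_nonneg _), ENNReal.ofReal_natCast]
  set G := {ω | IsConfidenceBand k (ξ ^ 2) (betaBayes (Fintype.card A) δ) (f · ω) (x · ω) (y · ω)}
  have hcompl : P Gᶜ ≤ ENNReal.ofReal δ := by
    rw [hsum]
    exact measure_not_isConfidenceBand_le hη hf hξ hsel hx hy fun _ => Real.sqrt_nonneg _
  have hcover : 1 ≤ P G + P Gᶜ := by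
    rw [← measure_univ (μ := P), ← Set.union_compl_self G]
    exact measure_union_le _ _
  rw [ENNReal.ofReal_sub _ hδ.le, ENNReal.ofReal_one, tsub_le_iff_right]
  exact hcover.trans (add_le_add_right hcompl _)

end AdaptiveSelection

end Probability

end MiniGP

end

theorem mainTheorem4 :
    ∃ p : ℕ, ∀ κ ξ : ℝ, 0 < ξ → ∃ K : ℝ, 0 < K ∧
      ∀ (A : Type*) [Fintype A] [Nonempty A] (k : A → A → ℝ) (_hk : ∀ a, k a a ≤ κ ^ 2)
        (Ω : Type*) [MeasurableSpace Ω] (P : Measure Ω) [IsProbabilityMeasure P]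
        (f : A → Ω → ℝ) (_hf : MiniGP.IsCenteredGP k f P)
        (η : ℕ → Ω → ℝ) (_hη : MiniGP.IsGaussianNoise ξ f η P)
        (C δ : ℝ) (_hC : 1 < C) (_hδ : 0 < δ) (_hδ' : δ ≤ 1)
        (sel : (t : ℕ) → (Fin t → ℝ) → A)
        (_hsel : MiniGP.IsMiniGPUCB k (ξ ^ 2) C (MiniGP.betaBayes (Fintype.card A) δ) sel)
        (x : ℕ → Ω → A) (y : ℕ → Ω → ℝ)
        (_hx : ∀ t ω, x t ω = sel t (fun i => y i ω))
        (_hy : ∀ t ω, y t ω = f (x t ω) ω + η t ω),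
        ENNReal.ofReal (1 - δ) ≤
          P {ω | ∀ T : ℕ, 1 ≤ T →
            MiniGP.regret (fun a => f a ω) (fun t => x t ω) T ≤
              K * (1 + Real.log (Fintype.card A * T / δ)) ^ p *
                (C * Real.sqrt (T * MiniGP.maxInfoGain k ξ T))} := by
  refine ⟨1, fun κ ξ hξ => ⟨4 * √(2 * (1 + 1 / ξ ^ 2) * (ξ ^ 2 + κ ^ 2)), by positivity, ?_⟩⟩
  intro A _ _ k hk Ω _ P _ f hf η hη C δ hC hδ hδ' sel hsel x y hx hy
  refine (MiniGP.ofReal_one_sub_le_measure_isConfidenceBand hη hf hξ.ne' hsel.measurable hx hy hδ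
    hδ').trans (measure_mono fun ω hconf T hT => ?_)
  have hrun := hsel.isRun (y · ω)
  simp only [← hx] at hrun
  have hregret := MiniGP.regret_le_of_isConfidenceBand hf.inner_toLp hk hξ.ne' hC.le
    (MiniGP.monotone_betaBayes _ hδ) (fun _ => Real.sqrt_nonneg _) hrun hconf T
  calc MiniGP.regret (f · ω) (x · ω) T
      ≤ 2 * √(2 * (1 + 1 / ξ ^ 2) * (ξ ^ 2 + κ ^ 2)) * MiniGP.betaBayes (Fintype.card A) δ T *
          (C * √(T * MiniGP.maxInfoGain k ξ T)) := hregret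
    _ ≤ 2 * √(2 * (1 + 1 / ξ ^ 2) * (ξ ^ 2 + κ ^ 2)) *
          (2 * (1 + Real.log (Fintype.card A * T / δ))) *
          (C * √(T * MiniGP.maxInfoGain k ξ T)) := by
        gcongr
        exact MiniGP.betaBayes_le Fintype.card_pos hδ hδ' hT
    _ = _ := by ring
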